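/- A distribution function is a nondecreasing, upper semicontinuous function $F:\mathbb{R}\to[0,1]$ such that $0$ and $1$ belong to the closure of $F(\mathbb{R})$; let $\mathcal{F}$ be the set of all of them. For $F,G\in\mathcal{F}$ and $b,x\in\mathbb{R}$ let $F\wedge G$ be the pointwise maximum of $F$ and $G$ (their meet for first order stochastic dominance), let $F+b$ be the function $y\mapsto F(y-b)$, and let $F_x\in\mathcal{F}$ be the point mass at $x$, that is, $F_x(y)=0$ for $y<x$ and $F_x(y)=1$ for $y\ge x$. Write $F_n\to F$ if $F_n(y)\to F(y)$ at every continuity point $y$ of $F$. For a binary relation $\succeq$ on $\mathcal{F}$ write $F\sim G$ if $F\succeq G$ and $G\succeq F$, and $F\succ G$ if $F\succeq G$ and not $G\succeq F$. **Theorem.** A binary relation $\succeq$ on $\mathcal{F}$ satisfies the five axioms 1. (weak order) $\succeq$ is complete ($F\succeq G$ or $G\succeq F$ for all $F,G\in\mathcal{F}$) and transitive; 2. (ordinal meet separability) for all $F,G\in\mathcal{F}$, if $G\succeq F$, then $F\wedge G\sim F$; 3. (ordinal translation invariance) for all $F,G\in\mathcal{F}$ and $b\in\mathbb{R}$, if $F\succeq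 G$, then $F+b\succeq G+b$; 4. (ordinal upper semicontinuity) for all $F,G\in\mathcal{F}$ and all sequences $(F_n)$ in $\mathcal{F}$, if $F_n\succeq G$ for all $n$ and $F_n\to F$, then $F\succeq G$; 5. (lower unboundedness) for every $F\in\mathcal{F}$ there is $x\in\mathbb{R}$ with $F\succ F_x$; if and only if there is a function $\rho:\mathcal{F}\to\mathbb{R}$ such that $F\succeq G\iff\rho(F)\ge\rho(G)$ for all $F,G\in\mathcal{F}$, and such that * (meet separability) $\rho(F\wedge G)=\min\{\rho(F),\rho(G)\}$ for all $F,G\in\mathcal{F}$; * (translation equivariance) $\rho(F+b)=\rho(F)+b$ for all $F\in\mathcal{F}$ and $b\in\mathbb{R}$; * (upper semicontinuity) for every $F\in\mathcal{F}$, every sequence $(F_n)$ in $\mathcal{F}$ and every $a\in\mathbb{R}$, if $\rho(F_n)\ge a$ for all $n$ and $F_n\to F$, then $\rho(F)\ge a$. -/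

import Mathlib

open Filter Topology

/-- A distribution function on `ℝ`: a nondecreasing, upper semicontinuous function with values in
`[0, 1]` such that `0` and `1` lie in the closure of its range. -/
@[ext]
structure DistFun where
  toFun : ℝ → ℝ
  monotone : Monotone toFun
  usc : UpperSemicontinuous toFun
  range_subset : Set.range toFun ⊆ Set.Icc 0 1
  subset_closure : {0, 1} ⊆ closure (Set.range toFun)

namespace DistFun

instance : CoeFun DistFun (fun _ => ℝ → ℝ) := ⟨DistFun.toFun⟩

theorem mem_Icc (F : DistFun) (x : ℝ) : F x ∈ Set.Icc (0 : ℝ) 1 :=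
  F.range_subset ⟨x, rfl⟩

theorem exists_lt (F : DistFun) {ε : ℝ} (hε : 0 < ε) : ∃ x, F x < ε := by
  have h : (0 : ℝ) ∈ closure (Set.range F.toFun) := F.subset_closure (by simp)
  obtain ⟨_, ⟨x, rfl⟩, hx⟩ := Metric.mem_closure_iff.1 h ε hε
  rw [Real.dist_eq, abs_lt] at hx
  exact ⟨x, by linarith [hx.1]⟩

theorem exists_gt (F : DistFun) {ε : ℝ} (hε : 0 < ε) : ∃ x, 1 - ε < F x := by
  have h : (1 : ℝ) ∈ closure (Set.range F.toFun) := F.subset_closure (by simp)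
  obtain ⟨_, ⟨x, rfl⟩, hx⟩ := Metric.mem_closure_iff.1 h ε hε
  rw [Real.dist_eq, abs_lt] at hx
  exact ⟨x, by linarith [hx.2]⟩

theorem subset_closure_of {f : ℝ → ℝ} (hf : Set.range f ⊆ Set.Icc 0 1)
    (h0 : ∀ ε > 0, ∃ x, f x < ε) (h1 : ∀ ε > 0, ∃ x, 1 - ε < f x) :
    {0, 1} ⊆ closure (Set.range f) := by
  rintro y (rfl | rfl)
  · refine Metric.mem_closure_iff.2 fun ε hε => ?_
    obtain ⟨x, hx⟩ := h0 ε hε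
    refine ⟨f x, ⟨x, rfl⟩, ?_⟩
    rw [Real.dist_eq, abs_lt]
    have := (hf ⟨x, rfl⟩).1
    constructor <;> linarith
  · refine Metric.mem_closure_iff.2 fun ε hε => ?_
    obtain ⟨x, hx⟩ := h1 ε hε
    refine ⟨f x, ⟨x, rfl⟩, ?_⟩
    rw [Real.dist_eq, abs_lt]
    have := (hf ⟨x, rfl⟩).2
    constructor <;> linarith

/-- The meet of two distribution functions for first order stochastic dominance, in which `G`
dominates `F` when `G x ≤ F x` for all `x`: the pointwise maximum. -/
def meet (F G : DistFun) : DistFun where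
  toFun x := max (F x) (G x)
  monotone := F.monotone.max G.monotone
  usc := F.usc.sup G.usc
  range_subset := by
    rintro _ ⟨x, rfl⟩
    exact ⟨le_max_of_le_left (F.mem_Icc x).1, max_le (F.mem_Icc x).2 (G.mem_Icc x).2⟩
  subset_closure := by
    apply subset_closure_of
    · rintro _ ⟨x, rfl⟩
      exact ⟨le_max_of_le_left (F.mem_Icc x).1, max_le (F.mem_Icc x).2 (G.mem_Icc x).2⟩
    · intro ε hε
      obtain ⟨x, hx⟩ := F.exists_lt hε
      obtain ⟨y, hy⟩ := G.exists_lt hε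
      exact ⟨min x y, max_lt ((F.monotone (min_le_left x y)).trans_lt hx)
        ((G.monotone (min_le_right x y)).trans_lt hy)⟩
    · intro ε hε
      obtain ⟨x, hx⟩ := F.exists_gt hε
      exact ⟨x, lt_max_of_lt_left hx⟩

/-- The translate `F + b`, that is `F ∘ h⁻¹` with `h x = x + b`. -/
def translate (F : DistFun) (b : ℝ) : DistFun where
  toFun x := F (x - b)
  monotone := fun _ _ h => F.monotone (sub_le_sub_right h b)
  usc := F.usc.comp (continuous_id.sub continuous_const)
  range_subset := by
    rintro _ ⟨x, rfl⟩
    exact F.mem_Icc (x - b)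
  subset_closure := by
    have h : Set.range (fun x => F (x - b)) = Set.range F.toFun :=
      (Equiv.subRight b).surjective.range_comp F.toFun
    rw [h]
    exact F.subset_closure

/-- The point mass at `a`: `0` to the left of `a`, and `1` from `a` on. -/
noncomputable def pointMass (a : ℝ) : DistFun where
  toFun y := if y < a then 0 else 1
  monotone := by
    intro x y h
    dsimp only
    split_ifs <;> linarith
  usc := by
    intro x c hc
    dsimp only at hc
    split_ifs at hc with hx
    · filter_upwards [Iio_mem_nhds hx] with y hy
      rwa [if_pos (Set.mem_Iio.1 hy)]
    · refine Eventually.of_forall fun y => ?_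
      dsimp only
      split_ifs <;> linarith
  range_subset := by
    rintro _ ⟨x, rfl⟩
    dsimp only
    split_ifs <;> norm_num
  subset_closure := by
    refine Set.Subset.trans ?_ _root_.subset_closure
    rintro y (rfl | rfl)
    · exact ⟨a - 1, by simp⟩
    · exact ⟨a, by simp⟩

/-- Weak convergence: pointwise convergence at every continuity point of the limit. -/
def WeakConv (Fs : ℕ → DistFun) (F : DistFun) : Prop :=
  ∀ x : ℝ, ContinuousAt F.toFun x → Tendsto (fun n => Fs n x) atTop (𝓝 (F x))

/-! ### Properties of a statistic `ρ` -/

def MeetSeparable (ρ : DistFun → ℝ) : Prop :=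
  ∀ F G : DistFun, ρ (F.meet G) = min (ρ F) (ρ G)

def TranslationEquivariant (ρ : DistFun → ℝ) : Prop :=
  ∀ (F : DistFun) (b : ℝ), ρ (F.translate b) = ρ F + b

def UpperSemicont (ρ : DistFun → ℝ) : Prop :=
  ∀ (Fs : ℕ → DistFun) (F : DistFun) (a : ℝ), (∀ n, a ≤ ρ (Fs n)) → WeakConv Fs F → a ≤ ρ F

/-! ### Properties of a binary relation `R`, where `R F G` reads "`F` is at least as good as `G`" -/

/-- Indifference. -/
def Indiff (R : DistFun → DistFun → Prop) (F G : DistFun) : Prop := R F G ∧ R G F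

/-- Strict preference. -/
def Strict (R : DistFun → DistFun → Prop) (F G : DistFun) : Prop := R F G ∧ ¬ R G F

/-- Complete and transitive. -/
def WeakOrder (R : DistFun → DistFun → Prop) : Prop :=
  (∀ F G, R F G ∨ R G F) ∧ ∀ F G H, R F G → R G H → R F H

def OrdinalMeetSeparable (R : DistFun → DistFun → Prop) : Prop :=
  ∀ F G : DistFun, R G F → Indiff R (F.meet G) F

def OrdinalTranslationInvariant (R : DistFun → DistFun → Prop) : Prop :=
  ∀ (F G : DistFun) (b : ℝ), R F G → R (F.translate b) (G.translate b)

def OrdinalUpperSemicont (R : DistFun → DistFun → Prop) : Prop :=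
  ∀ (Fs : ℕ → DistFun) (F G : DistFun), (∀ n, R (Fs n) G) → WeakConv Fs F → R F G

/-- Every distribution function is strictly preferred to some point mass. -/
def LowerUnbounded (R : DistFun → DistFun → Prop) : Prop :=
  ∀ F : DistFun, ∃ x : ℝ, Strict R F (pointMass x)

end DistFun

namespace DistFun

/-! The number `ρ F` is the certainty equivalent of `F`: the `x` with `F` indifferent to the point
mass at `x`. It exists because the point masses that `F` weakly beats form a half-line, bounded
above by `exists_not_rel_pointMass`, and upper semicontinuity along small upward translates gives
indifference at its supremum. It is unique, and represents `R`, because point masses are ranked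
strictly by location (`rel_pointMass_iff`). The properties of `ρ` are then the ordinal axioms read
through this representation. -/

theorem translate_pointMass (a b : ℝ) : (pointMass a).translate b = pointMass (a + b) := by
  ext y
  simp only [translate, pointMass, sub_lt_iff_lt_add]

/-- Translates by a null sequence converge weakly to the original distribution function. -/
theorem weakConv_translate (F : DistFun) {u : ℕ → ℝ} (hu : Tendsto u atTop (𝓝 0)) :
    WeakConv (fun n => F.translate (u n)) F := by
  intro y hy
  have h : Tendsto (fun n => y - u n) atTop (𝓝 y) := by
    simpa using (tendsto_const_nhds (x := y)).sub hu
  exact hy.tendsto.comp h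

/-- The join of two distribution functions for first order stochastic dominance: the pointwise
minimum. -/
def join (F G : DistFun) : DistFun where
  toFun x := min (F x) (G x)
  monotone := F.monotone.min G.monotone
  usc := F.usc.inf G.usc
  range_subset := by
    rintro _ ⟨x, rfl⟩
    exact ⟨le_min (F.mem_Icc x).1 (G.mem_Icc x).1, min_le_of_left_le (F.mem_Icc x).2⟩
  subset_closure := by
    apply subset_closure_of
    · rintro _ ⟨x, rfl⟩
      exact ⟨le_min (F.mem_Icc x).1 (G.mem_Icc x).1, min_le_of_left_le (F.mem_Icc x).2⟩
    · intro ε hε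
      obtain ⟨x, hx⟩ := F.exists_lt hε
      exact ⟨x, min_lt_of_left_lt hx⟩
    · intro ε hε
      obtain ⟨x, hx⟩ := F.exists_gt hε
      obtain ⟨y, hy⟩ := G.exists_gt hε
      exact ⟨max x y, lt_min (hx.trans_le (F.monotone (le_max_left x y)))
        (hy.trans_le (G.monotone (le_max_right x y)))⟩

/-- Joining `G` with ever lower translates of `F` approximates `G`. -/
theorem weakConv_join_translate (F G : DistFun) :
    WeakConv (fun n : ℕ => (F.translate (-(n : ℝ))).join G) G := by
  intro y _
  have h1 : Tendsto (fun n : ℕ => F (y - -(n : ℝ))) atTop (𝓝 1) := by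
    refine tendsto_order.2 ⟨fun c hc => ?_, fun c hc => ?_⟩
    · obtain ⟨x, hx⟩ := F.exists_gt (sub_pos.2 hc)
      obtain ⟨N, hN⟩ := exists_nat_ge (x - y)
      filter_upwards [eventually_ge_atTop N] with n hn
      have hn' : (N : ℝ) ≤ n := by exact_mod_cast hn
      have := F.monotone (show x ≤ y - -(n : ℝ) by linarith)
      linarith
    · exact Eventually.of_forall fun n => (F.mem_Icc _).2.trans_lt hc
  have h2 := h1.min (tendsto_const_nhds (x := G y))
  rwa [min_eq_right (G.mem_Icc y).2] at h2

section Relation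

variable {R : DistFun → DistFun → Prop}

/-- A relation that is complete and meet separable respects first order stochastic dominance. -/
theorem rel_of_le (hW : WeakOrder R) (hM : OrdinalMeetSeparable R) {F G : DistFun}
    (h : ∀ x, F x ≤ G x) : R F G := by
  rcases hW.1 F G with hFG | hGF
  · exact hFG
  · have hmeet : F.meet G = G := DistFun.ext (funext fun x => max_eq_right (h x))
    have := (hM F G hGF).2
    rwa [hmeet] at this

theorem rel_pointMass_of_le (hW : WeakOrder R) (hM : OrdinalMeetSeparable R) {x y : ℝ}
    (h : x ≤ y) : R (pointMass y) (pointMass x) := by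
  refine rel_of_le hW hM fun z => ?_
  simp only [pointMass]
  split_ifs <;> linarith

/-- If moving down from `y` to `x < y` did not hurt, translation invariance would let the move be
repeated: arbitrarily low point masses would be as good as the one at `0`, against lower
unboundedness. -/
theorem rel_pointMass_iff (hW : WeakOrder R) (hM : OrdinalMeetSeparable R)
    (hT : OrdinalTranslationInvariant R) (hL : LowerUnbounded R) {x y : ℝ} :
    R (pointMass x) (pointMass y) ↔ y ≤ x := by
  refine ⟨fun h => ?_, rel_pointMass_of_le hW hM⟩
  by_contra! hxy
  have hstep : ∀ n : ℕ, R (pointMass (n * (x - y))) (pointMass 0) := by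
    intro n
    induction n with
    | zero => simpa using rel_pointMass_of_le hW hM (le_refl (0 : ℝ))
    | succ n ih =>
      -- This shift takes `y` to `n * (x - y)` and `x` to `(n + 1) * (x - y)`.
      have := hT _ _ (n * (x - y) - y) h
      rw [translate_pointMass, translate_pointMass] at this
      refine hW.2 _ _ _ ?_ ih
      convert this using 2 <;> push_cast <;> ring
  obtain ⟨z, -, hz⟩ := hL (pointMass 0)
  obtain ⟨n, hn⟩ := exists_nat_ge (-z / (y - x))
  rw [div_le_iff₀ (sub_pos.2 hxy)] at hn
  exact hz (hW.2 _ _ _ (rel_pointMass_of_le hW hM (by linarith)) (hstep n))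

/-- No distribution function is weakly preferred to all point masses. -/
theorem exists_not_rel_pointMass (hW : WeakOrder R) (hM : OrdinalMeetSeparable R)
    (hT : OrdinalTranslationInvariant R) (hU : OrdinalUpperSemicont R) (hL : LowerUnbounded R)
    (F : DistFun) : ∃ x, ¬ R F (pointMass x) := by
  by_contra! h
  obtain ⟨z, -, hz⟩ := hL (pointMass 0)
  -- Every downward translate of `F` would still beat the point mass at `0`. Joining with the point
  -- mass at `z` only improves it, yet the limit is that point mass, which is strictly worse than
  -- the one at `0`.
  refine hz (hU _ _ _ (fun n => ?_) (weakConv_join_translate F (pointMass z)))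
  have h0 := hT _ _ (-(n : ℝ)) (h n)
  rw [translate_pointMass, add_neg_cancel] at h0
  exact hW.2 _ _ _ (rel_of_le hW hM fun x => min_le_left _ _) h0

/-- Every distribution function has a certainty equivalent. -/
theorem exists_indiff_pointMass (hW : WeakOrder R) (hM : OrdinalMeetSeparable R)
    (hT : OrdinalTranslationInvariant R) (hU : OrdinalUpperSemicont R) (hL : LowerUnbounded R)
    (F : DistFun) : ∃ x, Indiff R F (pointMass x) := by
  set S : Set ℝ := {x | R F (pointMass x)} with hS
  have hne : S.Nonempty := (hL F).imp fun x hx => hx.1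
  obtain ⟨M, hMS⟩ := exists_not_rel_pointMass hW hM hT hU hL F
  have hdown : ∀ {x y}, x ≤ y → y ∈ S → x ∈ S := fun hxy hy =>
    hW.2 _ _ _ hy (rel_pointMass_of_le hW hM hxy)
  have hbdd : BddAbove S := ⟨M, fun x hx => le_of_not_ge fun hMx => hMS (hdown hMx hx)⟩
  have hlim := tendsto_one_div_add_atTop_nhds_zero_nat (𝕜 := ℝ)
  refine ⟨sSup S, ?_, ?_⟩
  -- `F` beats the point mass slightly below `sSup S`; shifting both up moves the error onto `F`,
  -- where it vanishes in the limit.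
  · refine hU _ _ _ (fun n => ?_) (weakConv_translate F hlim)
    have hpos : (0 : ℝ) < 1 / ((n : ℝ) + 1) := by positivity
    obtain ⟨y, hyS, hy⟩ := exists_lt_of_lt_csSup hne (sub_lt_self (sSup S) hpos)
    have := hT _ _ (1 / ((n : ℝ) + 1)) (hdown hy.le hyS)
    rwa [translate_pointMass, sub_add_cancel] at this
  -- Point masses above `sSup S` lie outside `S`, so by completeness they beat `F`.
  · refine hU _ _ _ (fun n => ?_) (weakConv_translate (pointMass (sSup S)) hlim)
    have hpos : (0 : ℝ) < 1 / ((n : ℝ) + 1) := by positivity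
    rw [translate_pointMass]
    refine (hW.1 _ _).resolve_right fun h => ?_
    exact absurd (le_csSup hbdd h) (by linarith)

end Relation

end DistFun

theorem theorem4 (R : DistFun → DistFun → Prop) :
    (DistFun.WeakOrder R ∧ DistFun.OrdinalMeetSeparable R ∧
      DistFun.OrdinalTranslationInvariant R ∧ DistFun.OrdinalUpperSemicont R ∧
      DistFun.LowerUnbounded R) ↔
    ∃ ρ : DistFun → ℝ, (∀ F G : DistFun, R F G ↔ ρ G ≤ ρ F) ∧
      DistFun.MeetSeparable ρ ∧ DistFun.TranslationEquivariant ρ ∧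
      DistFun.UpperSemicont ρ := by
  constructor
  · rintro ⟨hW, hM, hT, hU, hL⟩
    choose ρ hρ using DistFun.exists_indiff_pointMass hW hM hT hU hL
    have hpm : ∀ {x y : ℝ}, R (DistFun.pointMass x) (DistFun.pointMass y) ↔ y ≤ x :=
      DistFun.rel_pointMass_iff hW hM hT hL
    have hrep : ∀ F G : DistFun, R F G ↔ ρ G ≤ ρ F := fun F G =>
      ⟨fun h => hpm.1 (hW.2 _ _ _ (hρ F).2 (hW.2 _ _ _ h (hρ G).1)),
        fun h => hW.2 _ _ _ (hρ F).1 (hW.2 _ _ _ (hpm.2 h) (hρ G).2)⟩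
    have hpoint : ∀ F x, R F (DistFun.pointMass x) ↔ x ≤ ρ F := fun F x =>
      ⟨fun h => hpm.1 (hW.2 _ _ _ (hρ F).2 h), fun h => hW.2 _ _ _ (hρ F).1 (hpm.2 h)⟩
    have hmeet : ∀ F G : DistFun, ρ F ≤ ρ G → ρ (F.meet G) = ρ F := fun F G h => by
      have hi := hM F G ((hrep G F).2 h)
      exact le_antisymm ((hrep _ _).1 hi.2) ((hrep _ _).1 hi.1)
    refine ⟨ρ, hrep, fun F G => ?_, fun F b => ?_, fun Fs F a ha hF => ?_⟩
    · rcases le_total (ρ F) (ρ G) with h | h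
      · rw [min_eq_left h, hmeet F G h]
      · have hcomm : F.meet G = G.meet F := DistFun.ext (funext fun x => max_comm _ _)
        rw [min_eq_right h, hcomm, hmeet G F h]
    · have h1 := hT _ _ b (hρ F).1
      have h2 := hT _ _ b (hρ F).2
      rw [DistFun.translate_pointMass] at h1 h2
      exact le_antisymm (hpm.1 (hW.2 _ _ _ h2 (hρ _).1)) ((hpoint _ _).1 h1)
    · exact (hpoint F a).1 (hU Fs F _ (fun n => (hpoint _ a).2 (ha n)) hF)
  · rintro ⟨ρ, hrep, hM, hT, hU⟩
    refine ⟨⟨fun F G => ?_, fun F G H hFG hGH => ?_⟩, fun F G h => ?_, fun F G b h => ?_,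
      fun Fs F G h hF => ?_, fun F => ?_⟩
    · simpa only [hrep] using le_total (ρ G) (ρ F)
    · rw [hrep] at *
      exact hGH.trans hFG
    · rw [hrep] at h
      simp only [DistFun.Indiff, hrep, hM F G, min_eq_left h, le_refl, and_self]
    · rw [hrep] at *
      rw [hT, hT]
      linarith
    · exact (hrep F G).2 (hU Fs F _ (fun n => (hrep _ _).1 (h n)) hF)
    -- By equivariance the point mass here has value `ρ F - 1`; `ρ` need not vanish on the point
    -- mass at `0`.
    · refine ⟨ρ F - ρ (DistFun.pointMass 0) - 1, ?_⟩
      have h := hT (DistFun.pointMass 0) (ρ F - ρ (DistFun.pointMass 0) - 1)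
      rw [DistFun.translate_pointMass, zero_add] at h
      simp only [DistFun.Strict, hrep, h]
      constructor <;> linarith
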